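/- Let $k\in\{4,6,8,10,14\}$. Let $E_k=1-\frac{2k}{B_k}\sum_{n\ge1}\sigma_{k-1}(n)q^n$ be the normalized Eisenstein series, $\Delta=(E_4^3-E_6^2)/1728$ and $j=E_4^3/\Delta=q^{-1}+744+\cdots$, regarded as Laurent series in $q$. For an element $c$ of a field of characteristic $0$ write $a_n\big(\frac{E_k}{j-c}\big)$ for the coefficient of $q^n$ in the Laurent series $F_{k,c}:=\frac{E_k}{j-c}$. (1) There are polynomials $P_{k,n}\in\mathbb Z[X]$ $(n\ge1)$, with $\deg P_{k,n}=n-1$, such that $$\frac{E_k}{j-X}=\sum_{n=1}^\infty P_{k,n}(X)\,q^n,$$ and for every prime $p$ and every $n\ge1$, $$P_{k,np}(X)\equiv P_{k,p}(X)\,P_{k,n}(X)^p\pmod p\quad\text{in }\mathbb Z[X].$$ (2) Let $p$ be a prime and let $c\in\overline{\mathbb Z_p}$, the integral closure of $\mathbb Z_p$ in an algebraic closure of $\mathbb Q_p$. Then $a_n(F_{k,c})\in\overline{\mathbb Z_p}$ for all $n\ge1$, and for all integers $n,l\ge1$, $$a_{np^l}(F_{k,c})\equiv a_p(F_{k,c})^{\frac{p^l-1}{p-1}}\,a_n(F_{k,c})^{p^l}\pmod{p\,\overline{\mathbb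 Z_p}}.$$ (3) Let $L$ be a number field, $\mathfrak p$ a nonzero prime ideal of its ring of integers, $p$ the rational prime below $\mathfrak p$, $\mathrm N(\mathfrak p)$ the cardinality of the residue field of $\mathfrak p$, and let $c\in L$ with $v_{\mathfrak p}(c)\ge0$. Then for all $n\ge1$, $a_n(F_{k,c})$ is integral at $\mathfrak p$ and $$a_{n\mathrm N(\mathfrak p)}(F_{k,c})\equiv a_p(F_{k,c})^{\frac{\mathrm N(\mathfrak p)-1}{p-1}}\,a_n(F_{k,c})\equiv a_{\mathrm N(\mathfrak p)}(F_{k,c})\,a_n(F_{k,c})\pmod{\mathfrak p},$$ where the congruences are between elements of the local ring $\{x\in L: v_{\mathfrak p}(x)\ge0\}$ modulo its maximal ideal. -/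

import Mathlib

open scoped PowerSeries LaurentSeries Polynomial NumberField

noncomputable section

namespace MeroModForm

/-- The normalized Eisenstein series `E_k = 1 - (2k / B_k) ∑_{n ≥ 1} σ_{k-1}(n) q^n`,
as a power series in `q` over a field `K` of characteristic zero. -/
def eisenstein (K : Type*) [Field K] (k : ℕ) : K⟦X⟧ :=
  PowerSeries.mk fun n =>
    if n = 0 then 1
    else (((-(2 * k / bernoulli k) * (ArithmeticFunction.sigma (k - 1) n : ℚ)) : ℚ) : K)

/-- The discriminant `Δ = (E_4^3 - E_6^2) / 1728 = q ∏ (1 - q^n)^24`. -/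
def delta (K : Type*) [Field K] : K⟦X⟧ :=
  PowerSeries.C (1728⁻¹ : K) * (eisenstein K 4 ^ 3 - eisenstein K 6 ^ 2)

/-- The `j`-invariant `j = E_4^3 / Δ = q^{-1} + 744 + 196884 q + ⋯`, a Laurent series in `q`. -/
def jInv (K : Type*) [Field K] : K⸨X⸩ :=
  ((eisenstein K 4 : K⟦X⟧) : K⸨X⸩) ^ 3 / ((delta K : K⟦X⟧) : K⸨X⸩)

/-- The meromorphic modular form `F_{k,c} = E_k / (j - c)`, as a Laurent series in `q`. -/
def formF (K : Type*) [Field K] (k : ℕ) (c : K) : K⸨X⸩ :=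
  ((eisenstein K k : K⟦X⟧) : K⸨X⸩) / (jInv K - HahnSeries.C c)

/-- The coefficient `a_n(F_{k,c})` of `q^n` in `E_k / (j - c)`. -/
def coeffF (K : Type*) [Field K] (k : ℕ) (c : K) (n : ℕ) : K :=
  (formF K k c).coeff (n : ℤ)

/-- Over `ℂ`, the series above is the `q`-expansion of the Eisenstein series of level one. -/
theorem qExpansion_E {k : ℕ} (hk : 3 ≤ k) (hk2 : Even k) :
    UpperHalfPlane.qExpansion 1 (ModularForm.E hk) = eisenstein ℂ k := by
  ext m
  rw [EisensteinSeries.E_qExpansion_coeff hk hk2 m, eisenstein, PowerSeries.coeff_mk]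
  split_ifs <;> push_cast <;> rfl

/-- Over `ℂ`, the series `delta` is the `q`-expansion of the modular discriminant `η^24`. -/
theorem qExpansion_discriminant :
    UpperHalfPlane.qExpansion 1 ModularForm.discriminant = delta ℂ := by
  have h12 : (ModularForm.discriminant : UpperHalfPlane → ℂ) =
      ⇑((1728⁻¹ : ℂ) • (ModularForm.mcast (by decide) (ModularForm.E₄.pow 3) -
        ModularForm.mcast (by decide) (ModularForm.E₆.pow 2) :
          ModularForm (Matrix.SpecialLinearGroup.mapGL ℝ : Matrix.SpecialLinearGroup (Fin 2) ℤ →*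
            GL (Fin 2) ℝ).range 12)) := by
    funext z
    rw [ModularForm.discriminant_eq_E₄_cube_sub_E₆_sq z]
    have h4 : (ModularForm.E₄.pow 3) z = ModularForm.E₄ z ^ 3 :=
      congrFun (ModularForm.coe_pow ModularForm.E₄ 3) z
    have h6 : (ModularForm.E₆.pow 2) z = ModularForm.E₆ z ^ 2 :=
      congrFun (ModularForm.coe_pow ModularForm.E₆ 2) z
    simp [div_eq_inv_mul]
    rw [← h4, ← h6]
  have h1 : (1 : ℝ) ∈ ((Matrix.SpecialLinearGroup.mapGL ℝ :
      Matrix.SpecialLinearGroup (Fin 2) ℤ →* GL (Fin 2) ℝ).range).strictPeriods := by simp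
  have h4 := qExpansion_E (k := 4) (by norm_num) ⟨2, rfl⟩
  have h6 := qExpansion_E (k := 6) (by norm_num) ⟨3, rfl⟩
  rw [h12, FunLike.coe_smul, ModularForm.qExpansion_smul one_pos h1, FunLike.coe_sub,
    ModularForm.qExpansion_sub one_pos h1, ModularForm.coe_mcast, ModularForm.coe_mcast,
    ModularForm.qExpansion_pow one_pos h1, ModularForm.qExpansion_pow one_pos h1, h4, h6, delta,
    PowerSeries.smul_eq_C_mul]

/-- The ring of integers of the algebraic closure of `ℚ_p`. -/
abbrev PadicBarInt (p : ℕ) [Fact p.Prime] : Subalgebra ℤ_[p] (PadicAlgCl p) :=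
  integralClosure ℤ_[p] (PadicAlgCl p)

/-- Congruence modulo a prime `𝔭` of a number field `L`, for elements of `L` which are integral
at `𝔭`: both sides lie in the local ring `{v_𝔭 ≥ 0}` and differ by an element of its maximal
ideal `{v_𝔭 > 0}`. -/
def PrimeCongr {L : Type*} [Field L] [NumberField L]
    (v : IsDedekindDomain.HeightOneSpectrum (𝓞 L)) (x y : L) : Prop :=
  v.valuation L x ≤ 1 ∧ v.valuation L y ≤ 1 ∧ v.valuation L (x - y) < 1

end MeroModForm

end

/-!
Write `h = g / Δ`, where `g` is the monomial in `E₄`, `E₆` with `E_k g = E₄² E₆`, so that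
`h E_k = - (q dj/dq)`. Expanding in powers of `1 / j`, the coefficient `P_n` of `q^n` in
`E_k / (j - X)` is a polynomial in `X` of degree `n - 1`, and the coefficient of `X^l` in it is that
of `q^n` in `E_k / j^(l+1)`.

The proof rests on a duality. The constant term of `h j^m · E_k j^(-l-1) = - j^(m-l-1) (q dj/dq)`
is `δ_{ml}` (`coeff_residue`), because `j^r dj` is exact unless `r = -1`. Consequently a polynomial
`G` equals `∑ a_n P_n`, where `a_n` is the coefficient of `q^{-n}` in `h G(j)` (`eq_sum_polyP`), and
`P_n` is characterized by `h P_n(j) = q^{-n} + O(1)` (`exists_homEval_polyP`,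
`eq_polyP_of_homEval`). This characterization remains valid modulo `p`.

Modulo `p`, the power `h^(p-1)` is a polynomial `c(j)` (`exists_pow_eq_homEval`). For `p ≤ 3` this
is clear, as `E₄ ≡ E₆ ≡ 1`. For `p ≥ 5`, von Staudt–Clausen gives `E_{p-1} ≡ 1`, so that
`g^(p-1) ≡ g^(p-1) E_{p-1}^(k-2)` is the reduction of a modular form of weight `12 (p-1)`, up to an
integer factor prime to `p`, and such a form with integral Fourier coefficients is `Δ^(p-1)` times
an integral polynomial in `j` (`exists_homEval_of_mem_qExpSpace`). Now `h c(j) = h^p = q^{-p} + O(1)`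
gives `c = P_p`, and `h P_p(j) P_n(j)^p = (h P_n(j))^p = q^{-np} + O(1)` gives `P_p P_n^p = P_{np}`
(`C_dvd_polyP_sub`).

The congruences for `p`-adic integers `c` and for `c` in a number field follow by iterating this
one, evaluating at `c`, and applying Fermat's little theorem in the residue field.

The formula for `q dj/dq` comes from Ramanujan's identities for the derivatives of `E₄` and `E₆`,
which hold because the Serre derivative preserves modularity (`serre`) and the spaces of modular
forms of weight `6` and `8` are one-dimensional. To stay within power series, `j` is replaced by
`u = q j` and the values `G(j)` by homogenized values `∑ Gᵢ uⁱ q^(N-i)` (`homEval`).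
-/

noncomputable section

namespace MeroModForm

section Analytic

/-! ### `q`-expansions and the Serre derivative -/

open UpperHalfPlane hiding I
open Derivative
open scoped MatrixGroups ModularForm

/-- `F` is the sum of the series `φ` in the local parameter `q = exp (2πiτ)`. -/
def HasQSeries (F : ℍ → ℂ) (φ : ℂ⟦X⟧) : Prop :=
  ∀ τ : ℍ, HasSum (fun m ↦ φ.coeff m • Function.Periodic.qParam 1 τ ^ m) (F τ)

lemma HasQSeries.sub {F G : ℍ → ℂ} {φ ψ : ℂ⟦X⟧} (hF : HasQSeries F φ) (hG : HasQSeries G ψ) :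
    HasQSeries (F - G) (φ - ψ) := fun τ ↦ by
  simpa [sub_mul] using (hF τ).sub (hG τ)

lemma HasQSeries.smul {F : ℍ → ℂ} {φ : ℂ⟦X⟧} (c : ℂ) (hF : HasQSeries F φ) :
    HasQSeries (c • F) (c • φ) := fun τ ↦ by
  simpa [mul_assoc] using (hF τ).mul_left c

lemma HasQSeries.mul {F G : ℍ → ℂ} {φ ψ : ℂ⟦X⟧} (hF : HasQSeries F φ) (hG : HasQSeries G ψ) :
    HasQSeries (F * G) (φ * ψ) := fun τ ↦ by
  have h1 := (hF τ).summable.norm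
  have h2 := (hG τ).summable.norm
  have h3 := (summable_norm_sum_mul_antidiagonal_of_summable_norm h1 h2).of_norm.hasSum
  rw [← tsum_mul_tsum_eq_tsum_sum_antidiagonal_of_summable_norm h1 h2, (hF τ).tsum_eq,
    (hG τ).tsum_eq] at h3
  refine h3.congr_fun fun n ↦ ?_
  simp only [PowerSeries.coeff_mul, smul_eq_mul, Finset.sum_mul]
  refine Finset.sum_congr rfl fun x hx ↦ ?_
  rw [← Finset.HasAntidiagonal.mem_antidiagonal.mp hx, pow_add]
  ring

lemma hasQSeries_modularForm {k : ℤ} (F : ModularForm 𝒮ℒ k) : HasQSeries F (qExpansion 1 F) :=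
  fun τ ↦ ModularForm.hasSum_qExpansion F one_pos one_mem_strictPeriods_SL τ

/-- The derivation `q d/dq` on power series. -/
def theta (R : Type*) [CommRing R] : Derivation R R⟦X⟧ R⟦X⟧ :=
  (PowerSeries.X : R⟦X⟧) • PowerSeries.derivative R

lemma coeff_theta {R : Type*} [CommRing R] (φ : R⟦X⟧) (n : ℕ) :
    (theta R φ).coeff n = n * φ.coeff n := by
  cases n with
  | zero => simp [theta]
  | succ n =>
    simp [theta, PowerSeries.coeff_succ_X_mul, PowerSeries.coeff_derivative, mul_comm]

lemma hasQSeries_deriv {k : ℤ} (F : ModularForm 𝒮ℒ k) :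
    HasQSeries (normalizedDerivOfComplex F) (theta ℂ (qExpansion 1 F)) := fun τ ↦ by
  have hper := SlashInvariantFormClass.periodic_comp_ofComplex F one_mem_strictPeriods_SL
  have hdiff := UpperHalfPlane.differentiableOn_cuspFunction_ball one_pos hper
    (ModularFormClass.holo F) (ModularFormClass.bdd_at_infty F)
  set g := cuspFunction 1 F with hg
  set q := Function.Periodic.qParam 1 (τ : ℂ) with hq
  have hq1 : ‖q‖ < 1 := Function.Periodic.norm_qParam_lt_one one_pos τ.im_pos
  have hD : normalizedDerivOfComplex F τ = q * deriv g q := by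
    have h1 : HasDerivAt g (deriv g q) q :=
      (hdiff.differentiableAt (Metric.isOpen_ball.mem_nhds (by simpa using hq1))).hasDerivAt
    have h2 : HasDerivAt (Function.Periodic.qParam 1) (q * (2 * Real.pi * Complex.I)) (τ : ℂ) := by
      have := (((hasDerivAt_id (τ : ℂ)).const_mul (2 * Real.pi * Complex.I)).div_const
        ((1 : ℝ) : ℂ)).cexp
      have hfun : Function.Periodic.qParam 1 =
          fun w : ℂ ↦ Complex.exp (2 * Real.pi * Complex.I * w) := by
        ext w
        simp [Function.Periodic.qParam]
      rw [hq, hfun]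
      simpa using this
    have h3 : (F : ℍ → ℂ) ∘ ofComplex =ᶠ[nhds (τ : ℂ)] g ∘ Function.Periodic.qParam 1 := by
      filter_upwards [isOpen_upperHalfPlaneSet.mem_nhds τ.im_pos] with w hw
      have := UpperHalfPlane.eq_cuspFunction (f := F) (⟨w, hw⟩ : ℍ) one_ne_zero hper
      simp only [Function.comp_apply]
      rw [hg, ofComplex_apply_of_im_pos hw]
      exact this.symm
    have h4 := (h1.comp (τ : ℂ) h2).congr_of_eventuallyEq h3
    rw [normalizedDerivOfComplex, h4.deriv]
    field_simp [Complex.two_pi_I_ne_zero]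
  have hT := Complex.hasSum_taylorSeries_on_ball (hdiff.deriv Metric.isOpen_ball)
    (show q ∈ Metric.ball 0 1 by simpa using hq1)
  rw [hD, ← hasSum_nat_add_iff' 1]
  simp only [Finset.range_one, Finset.sum_singleton, coeff_theta]
  simp only [Nat.cast_zero, zero_mul, zero_smul, sub_zero]
  refine (hT.mul_left q).congr_fun fun n ↦ ?_
  rw [qExpansion_coeff, ← hg, iteratedDeriv_succ', Nat.factorial_succ]
  simp only [smul_eq_mul, sub_zero]
  push_cast
  have : ((n : ℂ) + 1) ≠ 0 := by exact_mod_cast n.succ_ne_zero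
  field_simp
  ring

/-- The `q`-series of the quasimodular Eisenstein series `E₂`. -/
def eisensteinTwo : ℂ⟦X⟧ :=
  PowerSeries.mk fun m ↦ if m = 0 then 1 else -24 * (ArithmeticFunction.sigma 1 m : ℂ)

lemma hasQSeries_E2 : HasQSeries EisensteinSeries.E2 eisensteinTwo := fun τ ↦ by
  simpa only [eisensteinTwo, PowerSeries.coeff_mk, Function.Periodic.qParam, Complex.ofReal_one,
    div_one] using EisensteinSeries.hasSum_qExpansion_E2 (z := τ)

lemma hasQSeries_serreDerivative {k : ℤ} (F : ModularForm 𝒮ℒ k) :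
    HasQSeries (serreDerivative k F)
      (theta ℂ (qExpansion 1 F) - (k * 12⁻¹ : ℂ) • (eisensteinTwo * qExpansion 1 F)) := by
  convert (hasQSeries_deriv F).sub
    ((hasQSeries_E2.mul (hasQSeries_modularForm F)).smul (k * 12⁻¹ : ℂ)) using 1
  ext τ
  simp [serreDerivative, mul_assoc]

/-- The Serre derivative, as a map from modular forms of weight `k` to those of weight `k + 2`. -/
def serre {k : ℤ} (F : ModularForm 𝒮ℒ k) : ModularForm 𝒮ℒ (k + 2) where
  toFun := serreDerivative k F
  slash_action_eq' := fun _ ⟨γ, hγ⟩ ↦ hγ ▸ serreDerivative_slash_invariant (ModularFormClass.holo F)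
    (SlashInvariantForm.slash_action_eqn F _ ⟨γ, rfl⟩)
  holo' := serreDerivative_mdifferentiable _ (ModularFormClass.holo F)
  bdd_at_cusps' {c} hc := by
    rw [Subgroup.IsArithmetic.isCusp_iff_isCusp_SL2Z] at hc
    rw [OnePoint.isBoundedAt_iff_forall_SL2Z hc]
    intro γ _
    rw [serreDerivative_slash_invariant (ModularFormClass.holo F)
      (SlashInvariantForm.slash_action_eqn F _ ⟨γ, rfl⟩)]
    exact isBoundedAtImInfty_of_hasSum_qExpansion one_pos (hasQSeries_serreDerivative F)

lemma qExpansion_serre {k : ℤ} (F : ModularForm 𝒮ℒ k) :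
    qExpansion 1 (serre F) =
      theta ℂ (qExpansion 1 F) - (k * 12⁻¹ : ℂ) • (eisensteinTwo * qExpansion 1 F) := by
  ext m
  exact (ModularFormClass.qExpansion_coeff_unique one_pos one_mem_strictPeriods_SL
    (f := serre F) (hasQSeries_serreDerivative F) m).symm

/-! ### Spaces of `q`-expansions and Ramanujan's identities -/

/-- The space of `q`-expansions of level one modular forms of weight `k`. Working with it instead
of with the forms themselves makes weights that are only propositionally equal harmless. -/
def qExpSpace (k : ℤ) : Submodule ℂ ℂ⟦X⟧ where
  carrier := {φ | ∃ F : ModularForm 𝒮ℒ k, qExpansion 1 F = φ}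
  add_mem' := by
    rintro _ _ ⟨F, rfl⟩ ⟨G, rfl⟩
    exact ⟨F + G, ModularForm.qExpansion_add one_pos one_mem_strictPeriods_SL F G⟩
  zero_mem' := ⟨0, by simpa using qExpansion_zero 1⟩
  smul_mem' := by
    rintro c _ ⟨F, rfl⟩
    exact ⟨c • F, ModularForm.qExpansion_smul one_pos one_mem_strictPeriods_SL c F⟩

lemma mul_mem_qExpSpace {k l : ℤ} {φ ψ : ℂ⟦X⟧} (hφ : φ ∈ qExpSpace k) (hψ : ψ ∈ qExpSpace l) :
    φ * ψ ∈ qExpSpace (k + l) := by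
  obtain ⟨F, rfl⟩ := hφ
  obtain ⟨G, rfl⟩ := hψ
  exact ⟨F.mul G, ModularForm.qExpansion_mul one_pos one_mem_strictPeriods_SL F G⟩

lemma pow_mem_qExpSpace {k : ℤ} {φ : ℂ⟦X⟧} (hφ : φ ∈ qExpSpace k) (n : ℕ) :
    φ ^ n ∈ qExpSpace (n * k) := by
  obtain ⟨F, rfl⟩ := hφ
  exact ⟨F.pow n, ModularForm.qExpansion_pow one_pos one_mem_strictPeriods_SL F n⟩

lemma eisenstein_mem_qExpSpace {k : ℕ} (hk : 3 ≤ k) (hk2 : Even k) :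
    eisenstein ℂ k ∈ qExpSpace k :=
  ⟨ModularForm.E hk, qExpansion_E hk hk2⟩

lemma exists_eq_delta_mul {k : ℤ} {φ : ℂ⟦X⟧} (hφ : φ ∈ qExpSpace k)
    (h0 : PowerSeries.coeff 0 φ = 0) : ∃ ψ ∈ qExpSpace (k - 12), φ = delta ℂ * ψ := by
  obtain ⟨F, rfl⟩ := hφ
  refine ⟨_, ⟨CuspForm.discriminantEquiv (ModularForm.toCuspForm F h0), rfl⟩, ?_⟩
  rw [← qExpansion_discriminant]
  exact ModularForm.qExpansion_eq_qExpansion_discriminant_mul F h0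

lemma eq_zero_of_mem_qExpSpace_of_rank {k : ℤ} (hk : Module.rank ℂ (ModularForm 𝒮ℒ k) = 0)
    {φ : ℂ⟦X⟧} (hφ : φ ∈ qExpSpace k) : φ = 0 := by
  obtain ⟨F, rfl⟩ := hφ
  rw [rank_zero_iff_forall_zero.mp hk F]
  simpa using qExpansion_zero 1

/-- In weights below `12` and in weight `14` there are no cusp forms. -/
lemma eq_zero_of_mem_qExpSpace {k : ℤ} (hk : k < 12 ∨ k = 14) {φ : ℂ⟦X⟧} (hφ : φ ∈ qExpSpace k)
    (h0 : PowerSeries.coeff 0 φ = 0) : φ = 0 := by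
  obtain ⟨ψ, hψ, rfl⟩ := exists_eq_delta_mul hφ h0
  suffices ψ = 0 by simp [this]
  rcases hk with hk | rfl
  · exact eq_zero_of_mem_qExpSpace_of_rank
      (ModularForm.levelOne_neg_weight_rank_zero (by linarith)) hψ
  · exact eq_zero_of_mem_qExpSpace_of_rank ModularForm.levelOne_weight_two_rank_zero hψ

lemma eq_of_mem_qExpSpace {k : ℤ} (hk : k < 12 ∨ k = 14) {φ ψ : ℂ⟦X⟧} (hφ : φ ∈ qExpSpace k)
    (hψ : ψ ∈ qExpSpace k) (h0 : PowerSeries.coeff 0 φ = PowerSeries.coeff 0 ψ) : φ = ψ :=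
  sub_eq_zero.mp <| eq_zero_of_mem_qExpSpace hk (sub_mem hφ hψ) (by rw [map_sub, h0, sub_self])

lemma eq_C_of_mem_qExpSpace_zero {φ : ℂ⟦X⟧} (hφ : φ ∈ qExpSpace 0) :
    φ = PowerSeries.C (PowerSeries.coeff 0 φ) := by
  have h1 : (1 : ℂ⟦X⟧) ∈ qExpSpace 0 := ⟨1, ModularForm.qExpansion_one⟩
  refine eq_of_mem_qExpSpace (Or.inl (by norm_num)) hφ ?_ (by simp)
  simpa [PowerSeries.smul_eq_C_mul] using
    (qExpSpace 0).smul_mem (PowerSeries.coeff 0 φ) h1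

lemma theta_sub_mem_qExpSpace {k : ℤ} {φ : ℂ⟦X⟧} (hφ : φ ∈ qExpSpace k) :
    theta ℂ φ - (k * 12⁻¹ : ℂ) • (eisensteinTwo * φ) ∈ qExpSpace (k + 2) := by
  obtain ⟨F, rfl⟩ := hφ
  exact ⟨serre F, qExpansion_serre F⟩

lemma coeff_zero_eisenstein (K : Type*) [Field K] (k : ℕ) :
    PowerSeries.coeff 0 (eisenstein K k) = 1 := by
  simp [eisenstein, -PowerSeries.coeff_zero_eq_constantCoeff]

lemma constantCoeff_eisenstein (K : Type*) [Field K] (k : ℕ) :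
    PowerSeries.constantCoeff (eisenstein K k) = 1 := by
  rw [← PowerSeries.coeff_zero_eq_constantCoeff_apply, coeff_zero_eisenstein]

lemma constantCoeff_eisensteinTwo : PowerSeries.constantCoeff eisensteinTwo = 1 := by
  rw [← PowerSeries.coeff_zero_eq_constantCoeff_apply]
  simp [eisensteinTwo, -PowerSeries.coeff_zero_eq_constantCoeff]

lemma constantCoeff_theta {R : Type*} [CommRing R] (φ : R⟦X⟧) :
    PowerSeries.constantCoeff (theta R φ) = 0 := by
  rw [← PowerSeries.coeff_zero_eq_constantCoeff_apply, coeff_theta]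
  simp

lemma eisenstein_four_mem : eisenstein ℂ 4 ∈ qExpSpace 4 :=
  eisenstein_mem_qExpSpace (by norm_num) ⟨2, rfl⟩

lemma eisenstein_six_mem : eisenstein ℂ 6 ∈ qExpSpace 6 :=
  eisenstein_mem_qExpSpace (by norm_num) ⟨3, rfl⟩

/-- Ramanujan's identity `E₄' = (E₂ E₄ - E₆) / 3`. -/
lemma theta_eisenstein_four :
    3 * theta ℂ (eisenstein ℂ 4) = eisensteinTwo * eisenstein ℂ 4 - eisenstein ℂ 6 := by
  have h := eq_of_mem_qExpSpace (k := 6) (Or.inl (by norm_num))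
    (theta_sub_mem_qExpSpace eisenstein_four_mem)
    ((qExpSpace 6).smul_mem (-3⁻¹ : ℂ) eisenstein_six_mem)
    (by simp [constantCoeff_theta, constantCoeff_eisensteinTwo, constantCoeff_eisenstein]; norm_num)
  have h3 : (PowerSeries.C (3⁻¹ : ℂ)) * 3 = 1 := by
    rw [show (3 : ℂ⟦X⟧) = PowerSeries.C 3 from (map_ofNat _ _).symm, ← map_mul]; norm_num
  have h4 : ((4 : ℤ) : ℂ) * 12⁻¹ = 3⁻¹ := by norm_num
  rw [h4] at h
  simp only [PowerSeries.smul_eq_C_mul, map_neg] at h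
  linear_combination 3 * h + (eisensteinTwo * eisenstein ℂ 4 - eisenstein ℂ 6) * h3

/-- Ramanujan's identity `E₆' = (E₂ E₆ - E₄²) / 2`. -/
lemma theta_eisenstein_six :
    2 * theta ℂ (eisenstein ℂ 6) = eisensteinTwo * eisenstein ℂ 6 - eisenstein ℂ 4 ^ 2 := by
  have h := eq_of_mem_qExpSpace (k := 8) (Or.inl (by norm_num))
    (theta_sub_mem_qExpSpace eisenstein_six_mem)
    ((qExpSpace 8).smul_mem (-2⁻¹ : ℂ) (pow_mem_qExpSpace eisenstein_four_mem 2))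
    (by simp [constantCoeff_theta, constantCoeff_eisensteinTwo, constantCoeff_eisenstein]; norm_num)
  have h3 : (PowerSeries.C (2⁻¹ : ℂ)) * 2 = 1 := by
    rw [show (2 : ℂ⟦X⟧) = PowerSeries.C 2 from (map_ofNat _ _).symm, ← map_mul]; norm_num
  have h4 : ((6 : ℤ) : ℂ) * 12⁻¹ = 2⁻¹ := by norm_num
  rw [h4] at h
  simp only [PowerSeries.smul_eq_C_mul, map_neg] at h
  linear_combination 2 * h + (eisensteinTwo * eisenstein ℂ 6 - eisenstein ℂ 4 ^ 2) * h3

lemma eisenstein_pow_mul_pow_mem (a b : ℕ) :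
    eisenstein ℂ 4 ^ a * eisenstein ℂ 6 ^ b ∈ qExpSpace ((4 * a + 6 * b : ℕ) : ℤ) := by
  have := mul_mem_qExpSpace (pow_mem_qExpSpace eisenstein_four_mem a)
    (pow_mem_qExpSpace eisenstein_six_mem b)
  convert this using 2
  push_cast
  ring

/-- In weights `4, 6, 8, 10, 14` the Eisenstein series is a monomial in `E₄` and `E₆`, the space of
modular forms being one-dimensional. -/
lemma eisenstein_eq_pow_mul_pow {k a b : ℕ} (hk : k = 4 * a + 6 * b) (hk3 : 3 ≤ k)
    (hk' : k < 12 ∨ k = 14) :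
    eisenstein ℂ k = eisenstein ℂ 4 ^ a * eisenstein ℂ 6 ^ b := by
  refine eq_of_mem_qExpSpace (k := k) (by omega)
    (eisenstein_mem_qExpSpace hk3 ⟨2 * a + 3 * b, by omega⟩) ?_ ?_
  · subst hk
    exact eisenstein_pow_mul_pow_mem a b
  · simp [constantCoeff_eisenstein]

end Analytic

/-! ### Integral `q`-expansions -/

/-- `E₄` with integer coefficients. -/
def e4 : ℤ⟦X⟧ :=
  PowerSeries.mk fun n ↦ if n = 0 then 1 else 240 * (ArithmeticFunction.sigma 3 n : ℤ)

/-- `E₆` with integer coefficients. -/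
def e6 : ℤ⟦X⟧ :=
  PowerSeries.mk fun n ↦ if n = 0 then 1 else -504 * (ArithmeticFunction.sigma 5 n : ℤ)

lemma constantCoeff_e4 : PowerSeries.constantCoeff e4 = 1 := by
  rw [← PowerSeries.coeff_zero_eq_constantCoeff_apply, e4, PowerSeries.coeff_mk, if_pos rfl]

lemma constantCoeff_e6 : PowerSeries.constantCoeff e6 = 1 := by
  rw [← PowerSeries.coeff_zero_eq_constantCoeff_apply, e6, PowerSeries.coeff_mk, if_pos rfl]

lemma map_e4 (K : Type*) [Field K] [CharZero K] :
    PowerSeries.map (Int.castRingHom K) e4 = eisenstein K 4 := by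
  ext n
  have h : bernoulli 4 = -1 / 30 := by decide +kernel
  simp only [PowerSeries.coeff_map, e4, eisenstein, PowerSeries.coeff_mk, h]
  split_ifs
  · simp
  · push_cast
    norm_num

lemma map_e6 (K : Type*) [Field K] [CharZero K] :
    PowerSeries.map (Int.castRingHom K) e6 = eisenstein K 6 := by
  ext n
  have h : bernoulli 6 = 1 / 42 := by decide +kernel
  simp only [PowerSeries.coeff_map, e6, eisenstein, PowerSeries.coeff_mk, h]
  split_ifs
  · simp
  · push_cast
    norm_num

/-- This makes `E₄³ - E₆²` divisible by `1728`: its part linear in the divisor sums has coefficients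
`144 (5 σ₃(n) + 7 σ₅(n))`. -/
lemma dvd_five_sigma_add_seven_sigma (n : ℕ) :
    (12 : ℤ) ∣ 5 * (ArithmeticFunction.sigma 3 n : ℤ) + 7 * (ArithmeticFunction.sigma 5 n : ℤ) := by
  simp only [ArithmeticFunction.sigma_apply, Nat.cast_sum, Finset.mul_sum, ← Finset.sum_add_distrib]
  refine Finset.dvd_sum fun d _ ↦ ?_
  refine (ZMod.intCast_zmod_eq_zero_iff_dvd _ 12).mp ?_
  push_cast
  generalize (d : ZMod 12) = x
  revert x
  decide

lemma exists_C_mul_eq {m : ℤ} {φ : ℤ⟦X⟧} (h : ∀ n, m ∣ φ.coeff n) :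
    ∃ ψ : ℤ⟦X⟧, φ = PowerSeries.C m * ψ := by
  choose c hc using h
  exact ⟨PowerSeries.mk c, by ext n; rw [hc, PowerSeries.coeff_C_mul, PowerSeries.coeff_mk]⟩

lemma exists_e4_e6_eq : ∃ d : ℤ⟦X⟧, e4 ^ 3 - e6 ^ 2 = PowerSeries.C 1728 * d := by
  let s3 : ℤ⟦X⟧ := PowerSeries.mk fun n ↦ (ArithmeticFunction.sigma 3 n : ℤ)
  let s5 : ℤ⟦X⟧ := PowerSeries.mk fun n ↦ (ArithmeticFunction.sigma 5 n : ℤ)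
  have h4 : e4 = 1 + PowerSeries.C 240 * s3 := by
    ext n
    rw [map_add, PowerSeries.coeff_C_mul, PowerSeries.coeff_one, e4, PowerSeries.coeff_mk,
      PowerSeries.coeff_mk]
    split_ifs with hn
    · simp [hn]
    · ring
  have h6 : e6 = 1 - PowerSeries.C 504 * s5 := by
    ext n
    rw [map_sub, PowerSeries.coeff_C_mul, PowerSeries.coeff_one, e6, PowerSeries.coeff_mk,
      PowerSeries.coeff_mk]
    split_ifs with hn
    · simp [hn]
    · ring
  obtain ⟨r, hr⟩ : ∃ r : ℤ⟦X⟧,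
      PowerSeries.C 5 * s3 + PowerSeries.C 7 * s5 = PowerSeries.C 12 * r := by
    refine exists_C_mul_eq fun n ↦ ?_
    rw [map_add, PowerSeries.coeff_C_mul, PowerSeries.coeff_C_mul, PowerSeries.coeff_mk,
      PowerSeries.coeff_mk]
    exact dvd_five_sigma_add_seven_sigma n
  refine ⟨r + 100 * s3 ^ 2 + 8000 * s3 ^ 3 - 147 * s5 ^ 2, ?_⟩
  simp only [map_ofNat] at h4 h6 hr ⊢
  rw [h4, h6]
  linear_combination 144 * hr

lemma constantCoeff_e4_e6 : PowerSeries.constantCoeff (e4 ^ 3 - e6 ^ 2) = 0 := by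
  simp [constantCoeff_e4, constantCoeff_e6]

lemma exists_eq_X_mul_dl : ∃ d : ℤ⟦X⟧, e4 ^ 3 - e6 ^ 2 = 1728 * (PowerSeries.X * d) := by
  obtain ⟨d, hd⟩ := exists_e4_e6_eq
  have h0 : PowerSeries.constantCoeff d = 0 := by
    have := congrArg PowerSeries.constantCoeff hd
    rw [constantCoeff_e4_e6, map_mul, PowerSeries.constantCoeff_C] at this
    omega
  obtain ⟨r, rfl⟩ := PowerSeries.X_dvd_iff.mpr h0
  exact ⟨r, by rw [hd, map_ofNat]⟩

/-- The power series `Δ / q` with integer coefficients. -/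
def dl : ℤ⟦X⟧ := exists_eq_X_mul_dl.choose

lemma e4_e6_eq : e4 ^ 3 - e6 ^ 2 = 1728 * (PowerSeries.X * dl) := exists_eq_X_mul_dl.choose_spec

lemma map_X_mul_dl (K : Type*) [Field K] [CharZero K] :
    PowerSeries.map (Int.castRingHom K) (PowerSeries.X * dl) = delta K := by
  have h : (PowerSeries.C (1728⁻¹ : K)) * 1728 = 1 := by
    rw [show (1728 : K⟦X⟧) = PowerSeries.C 1728 from (map_ofNat _ _).symm, ← map_mul]; norm_num
  have h2 := congrArg (PowerSeries.map (Int.castRingHom K)) e4_e6_eq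
  rw [map_sub, map_pow, map_pow, map_e4, map_e6, map_mul, map_ofNat] at h2
  rw [delta, h2, ← mul_assoc, h, one_mul]

lemma constantCoeff_dl : PowerSeries.constantCoeff dl = 1 := by
  have h := ModularForm.discriminant_qExpansion_coeff_one
  rw [qExpansion_discriminant, ← map_X_mul_dl, PowerSeries.coeff_map,
    show 1 = 0 + 1 from rfl, PowerSeries.coeff_succ_X_mul] at h
  simpa using h

lemma map_intCast_injective (K : Type*) [Field K] [CharZero K] :
    Function.Injective (PowerSeries.map (Int.castRingHom K)) := fun φ ψ h ↦ by
  ext n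
  simpa using congrArg (PowerSeries.coeff n) h

lemma map_theta {R S : Type*} [CommRing R] [CommRing S] (f : R →+* S) (φ : R⟦X⟧) :
    PowerSeries.map f (theta R φ) = theta S (PowerSeries.map f φ) := by
  ext n
  simp [coeff_theta]

/-- The inverse of `Δ / q`. -/
def dlInv : ℤ⟦X⟧ := PowerSeries.invOfUnit dl 1

lemma dl_mul_dlInv : dl * dlInv = 1 :=
  PowerSeries.mul_invOfUnit _ _ (by simp [constantCoeff_dl])

/-- The power series `u = q j`. -/
def qj : ℤ⟦X⟧ := e4 ^ 3 * dlInv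

lemma dl_mul_qj : dl * qj = e4 ^ 3 := by
  rw [qj, mul_left_comm, dl_mul_dlInv, mul_one]

lemma constantCoeff_dlInv : PowerSeries.constantCoeff dlInv = 1 := by
  simpa [constantCoeff_dl] using congrArg PowerSeries.constantCoeff dl_mul_dlInv

lemma constantCoeff_qj : PowerSeries.constantCoeff qj = 1 := by
  simp [qj, constantCoeff_dlInv, constantCoeff_e4]

/-- The formula `q dj/dq = - E₄² E₆ / Δ`, written for `u = q j`. -/
lemma qj_sub_theta_qj : qj - theta ℤ qj = e4 ^ 2 * e6 * dlInv := by
  have hX : PowerSeries.X ≠ (0 : ℂ⟦X⟧) := PowerSeries.X_ne_zero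
  have hdl : PowerSeries.map (Int.castRingHom ℂ) dl ≠ 0 := fun h ↦ by
    have := congrArg PowerSeries.constantCoeff h
    rw [← PowerSeries.coeff_zero_eq_constantCoeff_apply, PowerSeries.coeff_map,
      PowerSeries.coeff_zero_eq_constantCoeff_apply, constantCoeff_dl] at this
    simp at this
  have key : PowerSeries.map (Int.castRingHom ℂ) ((qj - theta ℤ qj) * dl) =
      PowerSeries.map (Int.castRingHom ℂ) (e4 ^ 2 * e6) := by
    refine mul_left_cancel₀ hX ?_
    set D := PowerSeries.map (Int.castRingHom ℂ) dl
    set u := PowerSeries.map (Int.castRingHom ℂ) qj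
    have h1 : D * u = eisenstein ℂ 4 ^ 3 := by
      rw [← map_mul, dl_mul_qj, map_pow, map_e4]
    have h2 : eisenstein ℂ 4 ^ 3 - eisenstein ℂ 6 ^ 2 = 1728 * (PowerSeries.X * D) := by
      simpa only [map_sub, map_mul, map_pow, map_e4, map_e6, map_ofNat, PowerSeries.map_X] using
        congrArg (PowerSeries.map (Int.castRingHom ℂ)) e4_e6_eq
    have h3 := congrArg (theta ℂ) h1
    have h4 := congrArg (theta ℂ) h2
    have hX' : theta ℂ PowerSeries.X = PowerSeries.X := by simp [theta]
    have h1728 : theta ℂ (1728 : ℂ⟦X⟧) = 0 := by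
      simpa using (theta ℂ).map_natCast 1728
    simp only [map_sub, Derivation.leibniz, Derivation.leibniz_pow, smul_eq_mul, nsmul_eq_mul, hX',
      h1728] at h3 h4
    rw [map_mul, map_sub, map_theta, map_mul, map_pow, map_e4, map_e6]
    have r4 := theta_eisenstein_four
    have r6 := theta_eisenstein_six
    -- the logarithmic derivative of the discriminant is `E₂`
    have h5 : PowerSeries.X * theta ℂ D + PowerSeries.X * D =
        eisensteinTwo * (PowerSeries.X * D) := by
      have : (1728 : ℂ⟦X⟧) ≠ 0 := by
        rw [show (1728 : ℂ⟦X⟧) = PowerSeries.C 1728 from (map_ofNat _ _).symm, Ne,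
          map_eq_zero_iff _ PowerSeries.C_injective]
        norm_num
      refine mul_left_cancel₀ this ?_
      push_cast at h4
      linear_combination (-1 : ℂ⟦X⟧) * h4 + eisenstein ℂ 4 ^ 2 * r4 - eisenstein ℂ 6 * r6 +
        eisensteinTwo * h2
    push_cast at h3
    linear_combination (-PowerSeries.X) * h3 - PowerSeries.X * eisenstein ℂ 4 ^ 2 * r4 +
      u * h5 - (-1) * PowerSeries.X * eisensteinTwo * h1
  have h := map_intCast_injective ℂ key
  rw [← h, mul_assoc, dl_mul_dlInv, mul_one]

/-! ### Homogenized polynomials at a pair of power series -/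

/-- The value `∑ cᵢ xⁱ y^(n-i)` of the degree `n` homogenization of `c` at a pair of power series.
For `x = q j` and `y = q` it is `q^n c(j)`, provided that `c` has degree at most `n`. -/
def homEval {R : Type*} [CommRing R] (c : R[X]) (n : ℕ) (x y : R⟦X⟧) : R⟦X⟧ :=
  MvPolynomial.aeval ![x, y] (c.homogenize n)

section homEval

variable {R S : Type*} [CommRing R] [CommRing S]

lemma homEval_eq_sum (c : R[X]) (n : ℕ) (x y : R⟦X⟧) :
    homEval c n x y =
      ∑ i ∈ Finset.range (n + 1), PowerSeries.C (c.coeff i) * (x ^ i * y ^ (n - i)) := by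
  rw [homEval, Polynomial.homogenize, map_sum, Finset.Nat.sum_antidiagonal_eq_sum_range_succ_mk]
  refine Finset.sum_congr rfl fun i _ ↦ ?_
  rw [MvPolynomial.aeval_monomial, Finsupp.prod_fintype _ _ (by simp), Fin.prod_univ_two]
  simp

lemma homEval_mul {c d : R[X]} {m n : ℕ} (hc : c.natDegree ≤ m) (hd : d.natDegree ≤ n)
    (x y : R⟦X⟧) : homEval (c * d) (m + n) x y = homEval c m x y * homEval d n x y := by
  simp [homEval, Polynomial.homogenize_mul c d hc hd]

lemma homEval_C_mul (r : R) (c : R[X]) (n : ℕ) (x y : R⟦X⟧) :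
    homEval (Polynomial.C r * c) n x y = PowerSeries.C r * homEval c n x y := by
  rw [homEval, Polynomial.homogenize_C_mul, map_mul, MvPolynomial.aeval_C]
  rfl

lemma homEval_pow {c : R[X]} {n : ℕ} (hc : c.natDegree ≤ n) (x y : R⟦X⟧) (r : ℕ) :
    homEval (c ^ r) (r * n) x y = homEval c n x y ^ r := by
  induction r with
  | zero => simp [homEval]
  | succ r ih =>
    rw [pow_succ, pow_succ, Nat.succ_mul, homEval_mul _ hc, ih]
    exact (Polynomial.natDegree_pow_le).trans (Nat.mul_le_mul le_rfl hc)

lemma map_homEval (f : R →+* S) (c : R[X]) (n : ℕ) (x y : R⟦X⟧) :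
    PowerSeries.map f (homEval c n x y) =
      homEval (c.map f) n (PowerSeries.map f x) (PowerSeries.map f y) := by
  simp [homEval_eq_sum]

lemma homEval_mul_left (c : R[X]) (n : ℕ) (d x y : R⟦X⟧) :
    homEval c n (d * x) (d * y) = d ^ n * homEval c n x y := by
  simp only [homEval_eq_sum, Finset.mul_sum]
  refine Finset.sum_congr rfl fun i hi ↦ ?_
  have : d ^ n = d ^ i * d ^ (n - i) := by
    rw [← pow_add, Nat.add_sub_cancel' (Finset.mem_range_succ_iff.mp hi)]
  rw [this]
  ring

end homEval

/-! ### Integral structure of level one modular forms of weight divisible by `12` -/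

/-- A modular form of weight `12 N` with integral `q`-expansion is an integral linear combination
of the products `E₄^(3i) Δ^(N-i)`: subtract a multiple of `E₄^(3N)` and divide by `Δ`. -/
lemma exists_homEval_of_mem_qExpSpace (N : ℕ) (φ : ℤ⟦X⟧)
    (hφ : PowerSeries.map (Int.castRingHom ℂ) φ ∈ qExpSpace ((12 * N : ℕ) : ℤ)) :
    ∃ c : ℤ[X], c.natDegree ≤ N ∧ φ = homEval c N (e4 ^ 3) (PowerSeries.X * dl) := by
  induction N generalizing φ with
  | zero =>
    refine ⟨Polynomial.C (PowerSeries.coeff 0 φ), by simp, map_intCast_injective ℂ ?_⟩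
    have := eq_C_of_mem_qExpSpace_zero (by simpa using hφ)
    rw [this]
    simp [homEval_eq_sum]
  | succ N ih =>
    set a := PowerSeries.constantCoeff φ with ha
    set φ₁ := φ - PowerSeries.C a * (e4 ^ 3) ^ (N + 1) with hφ₁
    have h0 : PowerSeries.constantCoeff φ₁ = 0 := by
      simp [hφ₁, ← ha, constantCoeff_e4]
    obtain ⟨φ₂, hφ₂⟩ := PowerSeries.X_dvd_iff.mpr h0
    have hmem : PowerSeries.map (Int.castRingHom ℂ) φ₁ ∈ qExpSpace ((12 * (N + 1) : ℕ) : ℤ) := by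
      rw [hφ₁, map_sub, map_mul, map_pow, map_pow, map_e4, PowerSeries.map_C,
        ← PowerSeries.smul_eq_C_mul, ← pow_mul]
      refine sub_mem hφ (Submodule.smul_mem _ _ ?_)
      have := pow_mem_qExpSpace eisenstein_four_mem (3 * (N + 1))
      convert this using 2
      push_cast
      ring
    obtain ⟨ψ, hψ, hψ'⟩ := exists_eq_delta_mul hmem (by
      rw [PowerSeries.coeff_map, PowerSeries.coeff_zero_eq_constantCoeff_apply, h0, map_zero])
    have hψ₂ : PowerSeries.map (Int.castRingHom ℂ) (φ₂ * dlInv) = ψ := by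
      have h1 : PowerSeries.map (Int.castRingHom ℂ) dl * PowerSeries.map (Int.castRingHom ℂ) dlInv
          = 1 := by rw [← map_mul, dl_mul_dlInv, map_one]
      rw [hφ₂, ← map_X_mul_dl, map_mul, map_mul, mul_assoc] at hψ'
      have h2 := mul_left_cancel₀ (by simp) hψ'
      rw [map_mul, h2]
      linear_combination ψ * h1
    obtain ⟨c, hc, hcφ⟩ := ih (φ₂ * dlInv) (by
      rw [hψ₂]
      convert hψ using 2
      push_cast
      ring)
    refine ⟨c * 1 + Polynomial.C a * Polynomial.X ^ (N + 1), ?_, ?_⟩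
    · refine (Polynomial.natDegree_add_le _ _).trans (max_le ?_ ?_)
      · rw [mul_one]
        exact hc.trans N.le_succ
      · exact Polynomial.natDegree_C_mul_X_pow_le _ _
    · have h1 : homEval (c * 1 + Polynomial.C a * Polynomial.X ^ (N + 1)) (N + 1) (e4 ^ 3)
          (PowerSeries.X * dl) = homEval (c * 1) (N + 1) (e4 ^ 3) (PowerSeries.X * dl) +
            PowerSeries.C a * (e4 ^ 3) ^ (N + 1) := by
        rw [homEval, Polynomial.homogenize_add, Polynomial.homogenize_C_mul,
          Polynomial.homogenize_X_pow le_rfl]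
        simp [homEval]
      rw [h1, homEval_mul hc (by simp), ← hcφ,
        show homEval (1 : ℤ[X]) 1 (e4 ^ 3) (PowerSeries.X * dl) = PowerSeries.X * dl by
          simp [homEval]]
      linear_combination (-1 : ℤ⟦X⟧) * hφ₁ + hφ₂ - PowerSeries.X * φ₂ * dl_mul_dlInv

/-! ### The Hasse invariant -/

/-- The prime `p` divides the denominator of `B_{p-1}`, by the theorem of von Staudt and Clausen. -/
lemma dvd_den_bernoulli {p : ℕ} [hp : Fact p.Prime] {m : ℕ} (hm : p - 1 = 2 * m) :
    p ∣ (bernoulli (p - 1)).den := by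
  by_contra hB
  obtain ⟨T, hT⟩ := Bernoulli.vonStaudt_clausen m
  have h1 := hp.out.one_lt
  have hmem : p ∈ (Finset.range (2 * m + 2)).filter fun q ↦ q.Prime ∧ (q - 1) ∣ 2 * m :=
    Finset.mem_filter.mpr ⟨Finset.mem_range.mpr (by omega), hp.out, by rw [hm]⟩
  rw [← Finset.add_sum_erase _ _ hmem, ← hm] at hT
  have hval : Rat.padicValuation p (1 / p : ℚ) ≤ 1 := by
    have h2 : (1 / p : ℚ) = T - bernoulli (p - 1) - ∑ q ∈
        ((Finset.range (2 * m + 2)).filter fun q ↦ q.Prime ∧ (q - 1) ∣ 2 * m).erase p,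
          (1 : ℚ) / q := by
      rw [hm] at hT ⊢
      linear_combination -hT
    rw [h2]
    refine (Rat.padicValuation p).map_sub_le ((Rat.padicValuation p).map_sub_le ?_ ?_)
      ((Rat.padicValuation p).map_sum_le fun q hq ↦ ?_)
    · exact Int.padicValuation_le_one p T
    · exact Rat.padicValuation_le_one_iff.mpr hB
    · obtain ⟨hqp, hq⟩ := Finset.mem_erase.mp hq
      have hq' := (Finset.mem_filter.mp hq).2.1
      rw [Rat.padicValuation_le_one_iff, show ((1 : ℚ) / q).den = q by simp [hq'.ne_zero],
        Nat.prime_dvd_prime_iff_eq hp.out hq']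
      exact hqp.symm
  rw [Rat.padicValuation_le_one_iff] at hval
  exact hval (by rw [show ((1 : ℚ) / p).den = p by simp [hp.out.ne_zero]])

/-- Reduction modulo `p` of integral power series. -/
abbrev red (p : ℕ) : ℤ⟦X⟧ →+* (ZMod p)⟦X⟧ := PowerSeries.map (Int.castRingHom (ZMod p))

/-- For `p ≥ 5`, a multiple of `E_{p-1}` by an integer prime to `p` has an integral `q`-expansion
that is constant modulo `p`. -/
lemma exists_integral_multiple_eisenstein {p : ℕ} [hp : Fact p.Prime] (hp5 : 5 ≤ p) :
    ∃ (v : ℤ) (φ : ℤ⟦X⟧), (v : ZMod p) ≠ 0 ∧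
      PowerSeries.map (Int.castRingHom ℂ) φ ∈ qExpSpace ((p - 1 : ℕ) : ℤ) ∧
      red p φ = PowerSeries.C (v : ZMod p) := by
  obtain ⟨m, hm⟩ : ∃ m, p - 1 = 2 * m := by
    obtain ⟨m, hm⟩ := hp.out.odd_of_ne_two (by omega)
    exact ⟨m, by omega⟩
  obtain ⟨d, hd⟩ := dvd_den_bernoulli hm
  have hcop : (bernoulli (p - 1)).num.natAbs.Coprime (bernoulli (p - 1)).den :=
    (bernoulli (p - 1)).reduced
  have hv : ((bernoulli (p - 1)).num : ZMod p) ≠ 0 := fun h ↦ by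
    rw [ZMod.intCast_zmod_eq_zero_iff_dvd] at h
    exact hp.out.one_lt.ne' (Nat.eq_one_of_dvd_coprimes hcop (Int.natCast_dvd.mp h)
      (hd ▸ dvd_mul_right p d))
  set v := (bernoulli (p - 1)).num
  have hv0 : (v : ℚ) ≠ 0 := fun h ↦ hv (by rw [Int.cast_eq_zero.mp h, Int.cast_zero])
  have hB : (v : ℚ) * (2 * (p - 1 : ℕ) / bernoulli (p - 1)) = 2 * (p - 1 : ℕ) * (p * d : ℕ) := by
    have h1 : bernoulli (p - 1) = v / (p * d : ℕ) := by
      rw [← hd]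
      exact (Rat.num_div_den _).symm
    rw [h1]
    field_simp
  refine ⟨v, PowerSeries.mk fun n ↦ if n = 0 then v else
    -(2 * (p - 1 : ℕ) * (p * d : ℕ)) * (ArithmeticFunction.sigma (p - 1 - 1) n : ℤ), hv, ?_, ?_⟩
  · convert (qExpSpace ((p - 1 : ℕ) : ℤ)).smul_mem (v : ℂ)
      (eisenstein_mem_qExpSpace (k := p - 1) (by omega) ⟨m, by omega⟩) using 1
    ext n
    simp only [PowerSeries.coeff_map, PowerSeries.coeff_mk, eisenstein, PowerSeries.coeff_smul,
      smul_eq_mul]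
    split_ifs
    · simp
    · have h2 := congrArg (fun x : ℚ ↦ (x : ℂ)) hB
      simp only [eq_intCast]
      push_cast at h2 ⊢
      linear_combination (ArithmeticFunction.sigma (p - 1 - 1) n : ℂ) * h2
  · ext n
    rw [PowerSeries.coeff_map, PowerSeries.coeff_mk, PowerSeries.coeff_C]
    split_ifs <;> simp

/-- Modulo `p`, the power `(E₄^a E₆^b)^(p-1)` of a monomial of weight `14 - k` with `k ≥ 2` is a
form of weight `12 (p-1)` divided by a power of the Hasse invariant `E_{p-1} ≡ 1`, hence a
polynomial in `E₄³` and `Δ`. -/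
lemma exists_pow_eq_homEval {p : ℕ} [hp : Fact p.Prime] {a b k : ℕ} (hk : 4 * a + 6 * b + k = 14)
    (hk2 : 2 ≤ k) : ∃ c : (ZMod p)[X], c.natDegree ≤ p - 1 ∧
      red p (e4 ^ a * e6 ^ b) ^ (p - 1) =
        homEval c (p - 1) (red p (e4 ^ 3)) (red p (PowerSeries.X * dl)) := by
  rcases lt_or_ge p 5 with hp5 | hp5
  · -- here `E₄ ≡ E₆ ≡ 1`
    have hp23 : p = 2 ∨ p = 3 := by
      have := hp.out.two_le
      interval_cases p
      · exact Or.inl rfl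
      · exact Or.inr rfl
      · exact absurd hp.out (by norm_num)
    have h240 : (240 : ZMod p) = 0 ∧ (504 : ZMod p) = 0 := by
      have h1 : p ∣ 240 ∧ p ∣ 504 := by rcases hp23 with rfl | rfl <;> norm_num
      exact ⟨by exact_mod_cast (ZMod.natCast_eq_zero_iff 240 p).mpr h1.1,
        by exact_mod_cast (ZMod.natCast_eq_zero_iff 504 p).mpr h1.2⟩
    have h4 : red p e4 = 1 := by
      ext n
      rw [PowerSeries.coeff_map, e4, PowerSeries.coeff_mk, PowerSeries.coeff_one]
      split_ifs <;> simp [h240.1]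
    have h6 : red p e6 = 1 := by
      ext n
      rw [PowerSeries.coeff_map, e6, PowerSeries.coeff_mk, PowerSeries.coeff_one]
      split_ifs <;> simp [h240.2]
    refine ⟨Polynomial.X ^ (p - 1), Polynomial.natDegree_X_pow_le _, ?_⟩
    rw [homEval, Polynomial.homogenize_X_pow le_rfl]
    simp only [map_mul, map_pow, h4, h6]
    simp
  · obtain ⟨v, φ, hv, hφ, hφv⟩ := exists_integral_multiple_eisenstein hp5
    obtain ⟨c, hc, hcφ⟩ := exists_homEval_of_mem_qExpSpace (p - 1)
      ((e4 ^ a * e6 ^ b) ^ (p - 1) * φ ^ (k - 2)) (by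
        rw [map_mul, map_pow, map_mul, map_pow, map_pow, map_pow, map_e4, map_e6]
        convert mul_mem_qExpSpace (pow_mem_qExpSpace (eisenstein_pow_mul_pow_mem a b) (p - 1))
          (pow_mem_qExpSpace hφ (k - 2)) using 2
        have h1 : (12 : ℤ) = (4 * a + 6 * b : ℕ) + (k - 2 : ℕ) := by omega
        push_cast at h1 ⊢
        rw [h1]
        ring)
    refine ⟨Polynomial.C ((v : ZMod p) ^ (k - 2))⁻¹ * c.map (Int.castRingHom (ZMod p)),
      (Polynomial.natDegree_C_mul_le _ _).trans (Polynomial.natDegree_map_le.trans hc), ?_⟩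
    have h1 := congrArg (red p) hcφ
    rw [map_homEval, map_mul, map_pow, map_pow, hφv] at h1
    rw [homEval_C_mul, ← h1, mul_left_comm, ← map_pow PowerSeries.C, ← map_mul,
      inv_mul_cancel₀ (pow_ne_zero _ hv), map_one, mul_one]

/-! ### The residue pairing -/

/-- The inverse of `u = q j`. -/
def qjInv : ℤ⟦X⟧ := PowerSeries.invOfUnit qj 1

lemma qj_mul_qjInv : qj * qjInv = 1 :=
  PowerSeries.mul_invOfUnit _ _ (by simp [constantCoeff_qj])

/-- The power series `1 / j`. -/
def jRec : ℤ⟦X⟧ := PowerSeries.X * qjInv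

lemma constantCoeff_qjInv : PowerSeries.constantCoeff qjInv = 1 := by
  simpa [constantCoeff_qj] using congrArg PowerSeries.constantCoeff qj_mul_qjInv

/-- The residue of `j^(m-l-1) dj` at the cusp is `-δ_{ml}`: it is an exact differential unless
`m = l`, and a logarithmic one if `m = l`. -/
lemma coeff_residue (m l : ℕ) :
    PowerSeries.coeff (m + 1) ((qj - theta ℤ qj) * qj ^ m * jRec ^ (l + 1)) =
      if m = l then 1 else 0 := by
  rw [jRec, mul_pow, mul_left_comm]
  rcases lt_or_ge m l with hml | hml
  · rw [PowerSeries.coeff_X_pow_mul', if_neg (by omega), if_neg (by omega)]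
  obtain ⟨d, rfl⟩ := Nat.exists_eq_add_of_le hml
  rw [show l + d + 1 = d + (l + 1) by ring, PowerSeries.coeff_X_pow_mul]
  have hpow (r : ℕ) : qj ^ r * qjInv ^ r = 1 := by rw [← mul_pow, qj_mul_qjInv, one_pow]
  rcases d with _ | d
  · rw [if_pos (add_zero l), PowerSeries.coeff_zero_eq_constantCoeff_apply]
    simp [constantCoeff_theta, constantCoeff_qj, constantCoeff_qjInv]
  · rw [if_neg (by omega)]
    have h1 : (qj - theta ℤ qj) * qj ^ (l + (d + 1)) * qjInv ^ (l + 1) =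
        qj ^ (d + 1) - qj ^ d * theta ℤ qj := by
      rw [show l + (d + 1) = d + (l + 1) by ring, pow_add]
      linear_combination (qj ^ (d + 1) - qj ^ d * theta ℤ qj) * hpow (l + 1)
    have h2 : theta ℤ (qj ^ (d + 1)) = PowerSeries.C ((d + 1 : ℕ) : ℤ) *
        (qj ^ d * theta ℤ qj) := by
      simp [Derivation.leibniz_pow]
    have h3 := congrArg (PowerSeries.coeff (d + 1)) h2
    rw [coeff_theta, PowerSeries.coeff_C_mul] at h3
    have h4 := mul_left_cancel₀ (by exact_mod_cast d.succ_ne_zero) h3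
    rw [h1, map_sub, h4, sub_self]

/-! ### The polynomials `P_{k,n}` -/

/-- The coefficient of `q^n` in `f / (j - X) = ∑ l, X ^ l f / j ^ (l + 1)`. -/
def polyP (f : ℤ⟦X⟧) (n : ℕ) : ℤ[X] :=
  ∑ l ∈ Finset.range n, Polynomial.monomial l (PowerSeries.coeff n (f * jRec ^ (l + 1)))

lemma coeff_mul_jRec_pow {f : ℤ⟦X⟧} {n l : ℕ} (h : n < l) :
    PowerSeries.coeff n (f * jRec ^ l) = 0 := by
  rw [jRec, mul_pow, mul_left_comm, PowerSeries.coeff_X_pow_mul', if_neg (by omega)]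

lemma coeff_polyP (f : ℤ⟦X⟧) (n l : ℕ) :
    (polyP f n).coeff l = PowerSeries.coeff n (f * jRec ^ (l + 1)) := by
  rw [polyP, Polynomial.finsetSum_coeff]
  simp only [Polynomial.coeff_monomial]
  rw [Finset.sum_ite_eq' (Finset.range n) l]
  split_ifs with h
  · rfl
  · exact (coeff_mul_jRec_pow (by simpa [Nat.lt_succ_iff] using h)).symm

lemma polyP_zero (f : ℤ⟦X⟧) : polyP f 0 = 0 := by simp [polyP]

lemma natDegree_polyP_le (f : ℤ⟦X⟧) (n : ℕ) : (polyP f n).natDegree ≤ n - 1 := by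
  rw [Polynomial.natDegree_le_iff_coeff_eq_zero]
  intro l hl
  rw [coeff_polyP, coeff_mul_jRec_pow (by omega)]

lemma coeff_polyP_succ {f : ℤ⟦X⟧} (hf : PowerSeries.constantCoeff f = 1) (n : ℕ) :
    (polyP f (n + 1)).coeff n = 1 := by
  rw [coeff_polyP, jRec, mul_pow, mul_left_comm]
  have := PowerSeries.coeff_X_pow_mul (f * qjInv ^ (n + 1)) (n + 1) 0
  rw [zero_add] at this
  rw [this, PowerSeries.coeff_zero_eq_constantCoeff_apply]
  simp [hf, constantCoeff_qjInv]

lemma degree_polyP {f : ℤ⟦X⟧} (hf : PowerSeries.constantCoeff f = 1) (n : ℕ) :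
    (polyP f (n + 1)).degree = n := by
  refine le_antisymm (Polynomial.natDegree_le_iff_degree_le.mp (natDegree_polyP_le f (n + 1)))
    (Polynomial.le_degree_of_ne_zero ?_)
  rw [coeff_polyP_succ hf]
  exact one_ne_zero

lemma polyP_one {f : ℤ⟦X⟧} (hf : PowerSeries.constantCoeff f = 1) : polyP f 1 = 1 := by
  rw [Polynomial.eq_C_of_natDegree_le_zero (natDegree_polyP_le f 1), coeff_polyP_succ hf,
    Polynomial.C_1]

/-- The generating series of the `P_{k,n}` satisfies `𝒫 = f / j + X 𝒫 / j`. -/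
lemma mk_polyP (f : ℤ⟦X⟧) :
    PowerSeries.mk (polyP f) = PowerSeries.map Polynomial.C (f * jRec) +
      PowerSeries.C Polynomial.X *
        (PowerSeries.map Polynomial.C jRec * PowerSeries.mk (polyP f)) := by
  ext n l
  rw [PowerSeries.coeff_mk, map_add, PowerSeries.coeff_map, PowerSeries.coeff_C_mul,
    Polynomial.coeff_add, Polynomial.coeff_C, coeff_polyP]
  rcases l with _ | l
  · simp
  · rw [Polynomial.coeff_X_mul, if_neg l.succ_ne_zero, zero_add, pow_succ', mul_left_comm,
      PowerSeries.coeff_mul, PowerSeries.coeff_mul, Polynomial.finsetSum_coeff]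
    refine Finset.sum_congr rfl fun x _ ↦ ?_
    rw [PowerSeries.coeff_map, Polynomial.coeff_C_mul, PowerSeries.coeff_mk, coeff_polyP]

section Expansion

variable {R : Type*} [CommRing R] {f g : ℤ⟦X⟧}

/-- Duality: if `h = g / Δ` with `f g = E₄² E₆`, a polynomial `G` of degree at most `N` is the
combination of the `P_n` whose coefficients are those of `q^{-n}` in `h G(j)`. -/
lemma eq_sum_polyP (hfg : f * g = e4 ^ 2 * e6) {N : ℕ} {G : R[X]} (hG : G.natDegree ≤ N) :
    G = ∑ i ∈ Finset.range (N + 1),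
      Polynomial.C (PowerSeries.coeff (N - i) (PowerSeries.map (Int.castRingHom R) (g * dlInv) *
        homEval G N (PowerSeries.map (Int.castRingHom R) qj) PowerSeries.X)) *
      (polyP f (i + 1)).map (Int.castRingHom R) := by
  set ρ := PowerSeries.map (Int.castRingHom R)
  ext l
  simp only [Polynomial.finsetSum_coeff, Polynomial.coeff_C_mul, Polynomial.coeff_map, coeff_polyP]
  -- the `q^(N+1)`-coefficient of a product with `f / j^(l+1)`, which has no constant term
  have hconv (φ : R⟦X⟧) : ∑ i ∈ Finset.range (N + 1), PowerSeries.coeff (N - i) φ *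
      Int.castRingHom R (PowerSeries.coeff (i + 1) (f * jRec ^ (l + 1))) =
        PowerSeries.coeff (N + 1) (ρ (f * jRec ^ (l + 1)) * φ) := by
    rw [PowerSeries.coeff_mul, Finset.Nat.sum_antidiagonal_eq_sum_range_succ_mk,
      Finset.sum_range_succ' _ (N + 1), PowerSeries.coeff_map, coeff_mul_jRec_pow l.succ_pos,
      map_zero, zero_mul, add_zero]
    refine Finset.sum_congr rfl fun i _ ↦ ?_
    rw [PowerSeries.coeff_map, mul_comm, Nat.add_sub_add_right]
  rw [hconv, homEval_eq_sum, Finset.mul_sum, Finset.mul_sum, map_sum]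
  have h1 (i : ℕ) (hi : i ∈ Finset.range (N + 1)) : PowerSeries.coeff (N + 1)
      (ρ (f * jRec ^ (l + 1)) * (ρ (g * dlInv) *
        (PowerSeries.C (G.coeff i) * (ρ qj ^ i * PowerSeries.X ^ (N - i))))) =
          if i = l then G.coeff i else 0 := by
    have hi' := Finset.mem_range_succ_iff.mp hi
    have h2 : ρ (f * jRec ^ (l + 1)) * (ρ (g * dlInv) *
        (PowerSeries.C (G.coeff i) * (ρ qj ^ i * PowerSeries.X ^ (N - i)))) =
          PowerSeries.C (G.coeff i) * (PowerSeries.X ^ (N - i) *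
            ρ ((qj - theta ℤ qj) * qj ^ i * jRec ^ (l + 1))) := by
      rw [qj_sub_theta_qj, ← hfg]
      simp only [map_mul, map_pow]
      ring
    rw [h2, PowerSeries.coeff_C_mul, show N + 1 = i + 1 + (N - i) by omega,
      PowerSeries.coeff_X_pow_mul, PowerSeries.coeff_map, coeff_residue]
    split_ifs <;> simp
  rw [Finset.sum_congr rfl h1, Finset.sum_ite_eq']
  split_ifs with h
  · rfl
  · exact Polynomial.coeff_eq_zero_of_natDegree_lt (by
      have := Finset.mem_range_succ_iff.not.mp h
      omega)

/-- If `h G(j) = q^{-n} + O(1)`, then `G = P_n`. Here `n = N + 1`, and both sides are multiplied by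
`q^n`. -/
lemma eq_polyP_of_homEval (hfg : f * g = e4 ^ 2 * e6) {N : ℕ} {G : R[X]} (hG : G.natDegree ≤ N)
    {y : R⟦X⟧} (h : PowerSeries.map (Int.castRingHom R) (g * dlInv) *
      homEval G N (PowerSeries.map (Int.castRingHom R) qj) PowerSeries.X =
        1 + PowerSeries.X ^ (N + 1) * y) :
    G = (polyP f (N + 1)).map (Int.castRingHom R) := by
  rw [eq_sum_polyP hfg hG, h, Finset.sum_eq_single N]
  · simp
  · intro i hi hne
    have := Finset.mem_range_succ_iff.mp hi
    rw [map_add, PowerSeries.coeff_one, if_neg (by omega), PowerSeries.coeff_X_pow_mul',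
      if_neg (by omega)]
    simp
  · simp

/-- The polynomials `P_n` satisfy `h P_n(j) = q^{-n} + O(1)`. -/
lemma exists_homEval_polyP (hfg : f * g = e4 ^ 2 * e6) (hf : PowerSeries.constantCoeff f = 1)
    (N : ℕ) : ∃ y : ℤ⟦X⟧, g * dlInv * homEval (polyP f (N + 1)) N qj PowerSeries.X =
      1 + PowerSeries.X ^ (N + 1) * y := by
  let S : Polynomial.Sequence ℤ := ⟨fun i ↦ polyP f (i + 1), degree_polyP hf⟩
  have hG := eq_sum_polyP (R := ℤ) hfg (natDegree_polyP_le f (N + 1))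
  set φ := g * dlInv * homEval (polyP f (N + 1)) N qj PowerSeries.X with hφ
  have hid : Int.castRingHom ℤ = RingHom.id ℤ := RingHom.ext_int _ _
  simp only [hid, PowerSeries.map_id, Polynomial.map_id, id_eq,
    Nat.add_sub_cancel, ← hφ] at hG
  -- compare coefficients with respect to the basis of the `P_i`
  have hlin : ∑ i ∈ Finset.range (N + 1),
      (PowerSeries.coeff (N - i) φ - if i = N then 1 else 0) • S i = 0 := by
    simp only [sub_smul, Finset.sum_sub_distrib, ite_smul, one_smul, zero_smul,
      Finset.sum_ite_eq', Finset.mem_range_succ_iff, le_refl, if_true]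
    rw [sub_eq_zero]
    refine Eq.trans ?_ hG.symm
    exact Finset.sum_congr rfl fun i _ ↦ Polynomial.smul_eq_C_mul _
  have hcoeff := linearIndependent_iff'.mp S.linearIndependent _ _ hlin
  have hdvd : PowerSeries.X ^ (N + 1) ∣ φ - 1 := by
    rw [PowerSeries.X_pow_dvd_iff]
    intro m hm
    have := hcoeff (N - m) (Finset.mem_range_succ_iff.mpr (Nat.sub_le _ _))
    rw [Nat.sub_sub_self (by omega)] at this
    rw [map_sub, PowerSeries.coeff_one, ← this]
    congr 2
    simp only [eq_iff_iff]
    omega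
  obtain ⟨y, hy⟩ := hdvd
  exact ⟨y, by linear_combination hy⟩

end Expansion

/-! ### The congruence between the polynomials -/

lemma one_add_mul_pow_char {R : Type*} [CommRing R] (p : ℕ) [Fact p.Prime] [CharP R p] (x : R) :
    (1 + x) ^ p = 1 + x ^ p := by
  rw [add_pow_char, one_pow]

instance (p : ℕ) : CharP (ZMod p)⟦X⟧ p :=
  charP_of_injective_ringHom PowerSeries.C_injective p

/-- The congruence `P_{np} ≡ P_p P_n^p` modulo `p`. The polynomial `c` with `c(j) = h^(p-1)` is
`P_p`, since `h c(j) = h^p = q^{-p} + O(1)`, and `c P_n^p` is `P_{np}`, since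
`h c(j) P_n(j)^p = (h P_n(j))^p = q^{-np} + O(1)`. -/
lemma C_dvd_polyP_sub {f : ℤ⟦X⟧} {p a b k : ℕ} (hp : p.Prime) (hk : 4 * a + 6 * b + k = 14)
    (hk2 : 2 ≤ k) (hfg : f * (e4 ^ a * e6 ^ b) = e4 ^ 2 * e6)
    (hf : PowerSeries.constantCoeff f = 1) {n : ℕ} (hn : 0 < n) :
    Polynomial.C (p : ℤ) ∣ polyP f (n * p) - polyP f p * polyP f n ^ p := by
  have : Fact p.Prime := ⟨hp⟩
  obtain ⟨n, rfl⟩ := Nat.exists_eq_add_of_lt hn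
  rw [zero_add]
  obtain ⟨q, hp_def⟩ : ∃ q, p = q + 1 := ⟨p - 1, by have := hp.pos; omega⟩
  have hpq : p - 1 = q := by omega
  set ρ := Int.castRingHom (ZMod p)
  set h := red p (e4 ^ a * e6 ^ b * dlInv) with hh
  obtain ⟨c, hc, hcg⟩ := exists_pow_eq_homEval hk hk2 (p := p)
  rw [hpq] at hc hcg
  -- divide by `(Δ / q)^(p-1)`
  have hdl : red p dlInv * red p dl = 1 := by rw [← map_mul, mul_comm, dl_mul_dlInv, map_one]
  have hch : h ^ q = homEval c q (red p qj) PowerSeries.X := by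
    rw [← dl_mul_qj, (red p).map_mul dl, (red p).map_mul PowerSeries.X, PowerSeries.map_X,
      mul_comm PowerSeries.X, homEval_mul_left] at hcg
    rw [hh, map_mul, mul_pow, hcg, mul_right_comm, ← mul_pow, mul_comm (red p dl), hdl, one_pow,
      one_mul]
  obtain ⟨z, hz⟩ : ∃ z, h = 1 + PowerSeries.X * z := by
    obtain ⟨z, hz⟩ := PowerSeries.X_dvd_iff.mpr (show PowerSeries.constantCoeff (h - 1) = 0 by
      rw [map_sub, hh, ← PowerSeries.coeff_zero_eq_constantCoeff_apply, PowerSeries.coeff_map,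
        PowerSeries.coeff_zero_eq_constantCoeff_apply]
      simp [constantCoeff_e4, constantCoeff_e6, constantCoeff_dlInv])
    exact ⟨z, by linear_combination hz⟩
  have hcP : c = (polyP f p).map ρ := by
    rw [show polyP f p = polyP f (q + 1) by rw [← hp_def]]
    refine eq_polyP_of_homEval hfg hc (y := z ^ p) ?_
    rw [← hch, ← hh, ← pow_succ', ← hp_def]
    nth_rewrite 1 [hz]
    rw [one_add_mul_pow_char p, mul_pow]
  obtain ⟨y, hy⟩ := exists_homEval_polyP hfg hf n
  replace hy := congrArg (red p) hy
  rw [map_mul, map_homEval, PowerSeries.map_X, ← hh, map_add, map_one, map_mul, map_pow,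
    PowerSeries.map_X] at hy
  have hd : ((polyP f (n + 1)).map ρ).natDegree ≤ n :=
    Polynomial.natDegree_map_le.trans (natDegree_polyP_le f (n + 1))
  have key : c * (polyP f (n + 1)).map ρ ^ p = (polyP f (q + p * n + 1)).map ρ := by
    refine eq_polyP_of_homEval hfg (y := red p y ^ p) ?_ ?_
    · exact Polynomial.natDegree_mul_le.trans
        (Nat.add_le_add hc (Polynomial.natDegree_pow_le.trans (Nat.mul_le_mul le_rfl hd)))
    · rw [homEval_mul hc (Polynomial.natDegree_pow_le.trans (Nat.mul_le_mul le_rfl hd)),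
        homEval_pow hd, ← hch, ← hh, ← mul_assoc, ← pow_succ', ← hp_def, ← mul_pow, hy,
        one_add_mul_pow_char p, mul_pow, ← pow_mul]
      congr 3
      rw [hp_def]
      ring
  rw [show q + p * n + 1 = (n + 1) * p by rw [hp_def]; ring, hcP] at key
  rw [Polynomial.C_dvd_iff_dvd_coeff]
  intro i
  rw [← ZMod.intCast_zmod_eq_zero_iff_dvd]
  have := congrArg (fun r ↦ Polynomial.coeff r i) key
  rw [← Polynomial.map_pow, ← Polynomial.map_mul] at this
  simp only [Polynomial.coeff_map] at this
  rw [Polynomial.coeff_sub, Int.cast_sub, sub_eq_zero]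
  exact this.symm

/-! ### Specialization of the parameter -/

lemma jRec_mul_e4 : jRec * e4 ^ 3 = PowerSeries.X * dl := by
  rw [jRec, ← dl_mul_qj]
  linear_combination PowerSeries.X * dl * qj_mul_qjInv

lemma formF_eq {K : Type*} [Field K] [CharZero K] {k : ℕ} {f : ℤ⟦X⟧}
    (hf : PowerSeries.map (Int.castRingHom K) f = eisenstein K k) (c : K) :
    formF K k c =
      ((PowerSeries.mk fun n ↦ Polynomial.aeval c (polyP f n) : K⟦X⟧) : K⸨X⸩) := by
  set Φ : K⟦X⟧ := PowerSeries.mk fun n ↦ Polynomial.aeval c (polyP f n)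
  have h1 : Φ = PowerSeries.map (Int.castRingHom K) (f * jRec) +
      PowerSeries.C c * (PowerSeries.map (Int.castRingHom K) jRec * Φ) := by
    have h := congrArg (PowerSeries.map (Polynomial.aeval (R := ℤ) c).toRingHom) (mk_polyP f)
    have hcomp (φ : ℤ⟦X⟧) : PowerSeries.map (Polynomial.aeval (R := ℤ) c).toRingHom
        (PowerSeries.map Polynomial.C φ) = PowerSeries.map (Int.castRingHom K) φ := by
      ext n
      simp
    have hΦ : PowerSeries.map (Polynomial.aeval (R := ℤ) c).toRingHom (PowerSeries.mk (polyP f)) =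
        Φ := by
      ext n
      simp [Φ]
    rw [map_add, (PowerSeries.map _).map_mul (PowerSeries.C _), (PowerSeries.map _).map_mul
      (PowerSeries.map _ _), hcomp, hcomp, hΦ, PowerSeries.map_C] at h
    simpa using h
  have h2 : (eisenstein K 4 ^ 3 - PowerSeries.C c * delta K) * Φ = eisenstein K k * delta K := by
    have h3 := congrArg (PowerSeries.map (Int.castRingHom K)) jRec_mul_e4
    rw [map_mul, map_X_mul_dl, map_pow, map_e4] at h3
    rw [map_mul, hf] at h1
    linear_combination eisenstein K 4 ^ 3 * h1 + (eisenstein K k + PowerSeries.C c * Φ) * h3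
  have hΔ0 : PowerSeries.constantCoeff (delta K) = 0 := by
    rw [← map_X_mul_dl, map_mul, PowerSeries.map_X, map_mul, PowerSeries.constantCoeff_X, zero_mul]
  have hΔ : delta K ≠ 0 := fun h ↦ by
    rw [← map_X_mul_dl, map_eq_zero_iff _ (map_intCast_injective K)] at h
    have h' := congrArg (PowerSeries.coeff (0 + 1)) h
    rw [PowerSeries.coeff_succ_X_mul, PowerSeries.coeff_zero_eq_constantCoeff_apply,
      constantCoeff_dl] at h'
    exact one_ne_zero h'
  have hne : eisenstein K 4 ^ 3 - PowerSeries.C c * delta K ≠ 0 := fun h ↦ by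
    have h' := congrArg PowerSeries.constantCoeff h
    simp [constantCoeff_eisenstein, hΔ0] at h'
  have hinj := HahnSeries.ofPowerSeries_injective (Γ := ℤ) (R := K)
  have hΔ' : ((delta K : K⟦X⟧) : K⸨X⸩) ≠ 0 := (map_ne_zero_iff _ hinj).mpr hΔ
  have hne' : ((eisenstein K 4 ^ 3 - PowerSeries.C c * delta K : K⟦X⟧) : K⸨X⸩) ≠ 0 :=
    (map_ne_zero_iff _ hinj).mpr hne
  have h4 := congrArg (HahnSeries.ofPowerSeries ℤ K) h2
  have hj : jInv K - HahnSeries.C c =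
      ((eisenstein K 4 ^ 3 - PowerSeries.C c * delta K : K⟦X⟧) : K⸨X⸩) /
        ((delta K : K⟦X⟧) : K⸨X⸩) := by
    rw [jInv, map_sub, map_mul, map_pow, HahnSeries.ofPowerSeries_C]
    field_simp
  rw [map_mul, map_mul] at h4
  rw [formF, hj, div_div_eq_mul_div, div_eq_iff hne', ← h4, mul_comm]

/-- The monomials in `E₄` and `E₆` equal to Eisenstein series, over any field: both sides have
rational coefficients. -/
lemma map_e4_pow_mul_e6_pow {K : Type*} [Field K] [CharZero K] {k a b : ℕ}
    (hk : k = 4 * a + 6 * b) (hk3 : 3 ≤ k) (hk' : k < 12 ∨ k = 14) :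
    PowerSeries.map (Int.castRingHom K) (e4 ^ a * e6 ^ b) = eisenstein K k := by
  have hC := eisenstein_eq_pow_mul_pow hk hk3 hk'
  rw [← map_e4, ← map_e6, ← map_pow, ← map_pow, ← map_mul] at hC
  ext n
  have h := congrArg (PowerSeries.coeff n) hC
  simp only [PowerSeries.coeff_map, eisenstein, PowerSeries.coeff_mk, eq_intCast] at h ⊢
  rw [← Rat.cast_intCast]
  have h' : ((PowerSeries.coeff n (e4 ^ a * e6 ^ b) : ℤ) : ℚ) = if n = 0 then 1 else
      -(2 * k / bernoulli k) * (ArithmeticFunction.sigma (k - 1) n : ℚ) := by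
    apply Rat.cast_injective (α := ℂ)
    rw [Rat.cast_intCast, ← h]
    split_ifs <;> simp
  rw [h']
  split_ifs <;> simp

lemma coeffF_eq {K : Type*} [Field K] [CharZero K] {k : ℕ} {f : ℤ⟦X⟧}
    (hf : PowerSeries.map (Int.castRingHom K) f = eisenstein K k) (c : K) (n : ℕ) :
    coeffF K k c n = Polynomial.aeval c (polyP f n) := by
  rw [coeffF, formF_eq hf, LaurentSeries.coeff_coe_powerSeries, PowerSeries.coeff_mk]

/-! ### Iteration of the congruence -/

lemma C_dvd_sub_pow {P : ℕ → ℤ[X]} {p : ℕ} (hp : p.Prime)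
    (h : ∀ n, 0 < n → Polynomial.C (p : ℤ) ∣ P (n * p) - P p * P n ^ p) {n : ℕ} (hn : 0 < n)
    (l : ℕ) :
    Polynomial.C (p : ℤ) ∣ P (n * p ^ l) - P p ^ ((p ^ l - 1) / (p - 1)) * P n ^ p ^ l := by
  have hgeom (l : ℕ) : (p ^ l - 1) / (p - 1) = ∑ i ∈ Finset.range l, p ^ i :=
    (Nat.geomSum_eq hp.two_le l).symm
  induction l with
  | zero => simp
  | succ l ih =>
    have h1 := h (n * p ^ l) (Nat.mul_pos hn (pow_pos hp.pos l))
    have h2 := (ih.trans (sub_dvd_pow_sub_pow _ _ p)).mul_left (P p)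
    have h3 : P p ^ ((p ^ (l + 1) - 1) / (p - 1)) * P n ^ p ^ (l + 1) =
        P p * (P p ^ ((p ^ l - 1) / (p - 1)) * P n ^ p ^ l) ^ p := by
      rw [hgeom, hgeom, geom_sum_succ, pow_add, pow_one, mul_pow, ← pow_mul, ← pow_mul, ← pow_succ,
        mul_comm p]
      ring
    rw [h3, pow_succ, ← mul_assoc]
    convert h1.add h2 using 1
    ring

/-! ### Reduction at a prime of a number field -/

section NumberField

open IsDedekindDomain

variable {L : Type*} [Field L] [NumberField L] (v : HeightOneSpectrum (𝓞 L))

lemma valuation_aeval_le_one {c : L} (hc : v.valuation L c ≤ 1) (P : ℤ[X]) :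
    v.valuation L (Polynomial.aeval c P) ≤ 1 := by
  let c' : (v.valuation L).integer := ⟨c, hc⟩
  have : Polynomial.aeval c P = (v.valuation L).integer.subtype (Polynomial.aeval c' P) := by
    exact Polynomial.aeval_algHom_apply (v.valuation L).integer.subtype.toIntAlgHom c' P
  rw [this]
  exact (Polynomial.aeval c' P).2

lemma valuation_natCast_lt_one {p : ℕ} (hp : (p : 𝓞 L) ∈ v.asIdeal) :
    v.valuation L (p : L) < 1 := by
  have := (v.valuation_lt_one_iff_mem (K := L) (p : 𝓞 L)).mpr hp
  simpa using this

lemma valuation_aeval_sub_lt_one {p : ℕ} (hp : (p : 𝓞 L) ∈ v.asIdeal) {c : L}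
    (hc : v.valuation L c ≤ 1) {P Q : ℤ[X]} (h : Polynomial.C (p : ℤ) ∣ P - Q) :
    v.valuation L (Polynomial.aeval c P - Polynomial.aeval c Q) < 1 := by
  obtain ⟨D, hD⟩ := h
  rw [← map_sub, hD, map_mul, Polynomial.aeval_C, map_mul]
  refine mul_lt_one_of_lt_of_le ?_ (valuation_aeval_le_one v hc D)
  simpa using valuation_natCast_lt_one v hp

lemma exists_absNorm_eq_pow {p : ℕ} (hp : p.Prime) (hpv : (p : 𝓞 L) ∈ v.asIdeal) :
    ∃ r : ℕ, Ideal.absNorm v.asIdeal = p ^ r := by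
  have := v.isMaximal
  let _ := Ideal.Quotient.field v.asIdeal
  have hfin : Finite (𝓞 L ⧸ v.asIdeal) := Ideal.finiteQuotientOfFreeOfNeBot _ v.ne_bot
  let _ := Fintype.ofFinite (𝓞 L ⧸ v.asIdeal)
  have hp0 : (p : 𝓞 L ⧸ v.asIdeal) = 0 := by
    rw [← map_natCast (Ideal.Quotient.mk v.asIdeal)]
    exact Ideal.Quotient.eq_zero_iff_mem.mpr hpv
  have : CharP (𝓞 L ⧸ v.asIdeal) p := ringChar.of_eq (CharP.ringChar_of_prime_eq_zero hp hp0)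
  obtain ⟨r, -, hr⟩ := FiniteField.card (𝓞 L ⧸ v.asIdeal) p
  refine ⟨r, ?_⟩
  rw [← hr, Ideal.absNorm_apply, Submodule.cardQuot_apply, Nat.card_eq_fintype_card]

lemma pow_absNorm_sub_mem (a : 𝓞 L) : a ^ Ideal.absNorm v.asIdeal - a ∈ v.asIdeal := by
  have := v.isMaximal
  let _ := Ideal.Quotient.field v.asIdeal
  have hfin : Finite (𝓞 L ⧸ v.asIdeal) := Ideal.finiteQuotientOfFreeOfNeBot _ v.ne_bot
  let _ := Fintype.ofFinite (𝓞 L ⧸ v.asIdeal)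
  rw [← Ideal.Quotient.eq_zero_iff_mem, map_sub, map_pow, Ideal.absNorm_apply,
    Submodule.cardQuot_apply, Nat.card_eq_fintype_card, FiniteField.pow_card, sub_self]

/-- Fermat's little theorem in the residue field at `v`. -/
lemma valuation_pow_absNorm_sub_lt_one {x : L} (hx : v.valuation L x ≤ 1) :
    v.valuation L (x ^ Ideal.absNorm v.asIdeal - x) < 1 := by
  obtain ⟨a, ha⟩ := v.exists_valuation_sub_lt_of_integer hx 1
  have ha1 : v.valuation L (algebraMap (𝓞 L) L a) ≤ 1 := v.valuation_le_one a
  have h1 : v.valuation L (algebraMap (𝓞 L) L (a ^ Ideal.absNorm v.asIdeal - a)) < 1 :=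
    (v.valuation_lt_one_iff_mem _).mpr (pow_absNorm_sub_mem v a)
  set N := Ideal.absNorm v.asIdeal
  rw [map_sub (algebraMap (𝓞 L) L), map_pow] at h1
  have h2 : v.valuation L (algebraMap (𝓞 L) L a ^ N - x ^ N) < 1 := by
    obtain ⟨d, hd⟩ := sub_dvd_pow_sub_pow (⟨_, ha1⟩ : (v.valuation L).integer) ⟨x, hx⟩ N
    have := congrArg ((v.valuation L).integer.subtype) hd
    simp only [map_sub, map_pow, map_mul, Subring.subtype_apply] at this
    rw [this, map_mul]
    exact mul_lt_one_of_lt_of_le (by simpa using ha) d.2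
  have h3 : x ^ N - x = (algebraMap (𝓞 L) L a ^ N - algebraMap (𝓞 L) L a) -
      (algebraMap (𝓞 L) L a ^ N - x ^ N) + (algebraMap (𝓞 L) L a - x) := by ring
  rw [h3]
  exact (v.valuation L).map_add_lt ((v.valuation L).map_sub_lt h1 h2) (by simpa using ha)

end NumberField

end MeroModForm

end

theorem mainTheorem4 (k : ℕ) (hk : k ∈ ({4, 6, 8, 10, 14} : Set ℕ)) :
    -- the polynomials `P_{k,n}` and the congruence between them
    (∃ P : ℕ → ℤ[X],
      P 0 = 0 ∧
      (∀ n : ℕ, 0 < n → (P n).degree = ((n - 1 : ℕ) : WithBot ℕ)) ∧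
      MeroModForm.formF (FractionRing ℤ[X]) k (algebraMap ℤ[X] (FractionRing ℤ[X]) Polynomial.X) =
        ((PowerSeries.mk fun n => algebraMap ℤ[X] (FractionRing ℤ[X]) (P n) :
          (FractionRing ℤ[X])⟦X⟧) : (FractionRing ℤ[X])⸨X⸩) ∧
      ∀ p : ℕ, p.Prime → ∀ n : ℕ, 0 < n →
        Polynomial.C (p : ℤ) ∣ P (n * p) - P p * P n ^ p) ∧
    -- `p`-adic integral parameter `c`
    (∀ (p : ℕ) [Fact p.Prime] (c : MeroModForm.PadicBarInt p),
      ∃ a : ℕ → MeroModForm.PadicBarInt p,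
        (∀ n : ℕ, 0 < n →
          (a n : PadicAlgCl p) = MeroModForm.coeffF (PadicAlgCl p) k (c : PadicAlgCl p) n) ∧
        ∀ n l : ℕ, 0 < n → 0 < l →
          (p : MeroModForm.PadicBarInt p) ∣
            a (n * p ^ l) - a p ^ ((p ^ l - 1) / (p - 1)) * a n ^ (p ^ l)) ∧
    -- parameter `c` in a number field
    (∀ (L : Type*) [Field L] [NumberField L] (c : L)
      (v : IsDedekindDomain.HeightOneSpectrum (𝓞 L)) (p : ℕ),
      p.Prime → (p : 𝓞 L) ∈ v.asIdeal → v.valuation L c ≤ 1 →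
      ∀ n : ℕ, 0 < n →
        v.valuation L (MeroModForm.coeffF L k c n) ≤ 1 ∧
        MeroModForm.PrimeCongr v
          (MeroModForm.coeffF L k c (n * Ideal.absNorm v.asIdeal))
          (MeroModForm.coeffF L k c p ^ ((Ideal.absNorm v.asIdeal - 1) / (p - 1)) *
            MeroModForm.coeffF L k c n) ∧
        MeroModForm.PrimeCongr v
          (MeroModForm.coeffF L k c p ^ ((Ideal.absNorm v.asIdeal - 1) / (p - 1)) *
            MeroModForm.coeffF L k c n)
          (MeroModForm.coeffF L k c (Ideal.absNorm v.asIdeal) *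
            MeroModForm.coeffF L k c n)) := by
  obtain ⟨a, b, ha, hb, hkab⟩ : ∃ a b, a ≤ 2 ∧ b ≤ 1 ∧ k = 4 * a + 6 * b := by
    rcases hk with rfl | rfl | rfl | rfl | rfl
    exacts [⟨1, 0, by norm_num⟩, ⟨0, 1, by norm_num⟩, ⟨2, 0, by norm_num⟩, ⟨1, 1, by norm_num⟩,
      ⟨2, 1, by norm_num⟩]
  have hk' : 3 ≤ k ∧ (k < 12 ∨ k = 14) := by
    rcases hk with rfl | rfl | rfl | rfl | rfl <;> norm_num
  set f : ℤ⟦X⟧ := MeroModForm.e4 ^ a * MeroModForm.e6 ^ b with hf_def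
  have hf1 : PowerSeries.constantCoeff f = 1 := by
    simp [f, MeroModForm.constantCoeff_e4, MeroModForm.constantCoeff_e6]
  set P := MeroModForm.polyP f
  have hcongr (p : ℕ) (hp : p.Prime) (n : ℕ) (hn : 0 < n) :
      Polynomial.C (p : ℤ) ∣ P (n * p) - P p * P n ^ p := by
    -- the complementary monomial, of weight `14 - k`
    refine MeroModForm.C_dvd_polyP_sub (a := 2 - a) (b := 1 - b) (k := k) hp (by omega) (by omega)
      ?_ hf1 hn
    have h4 : MeroModForm.e4 ^ 2 = MeroModForm.e4 ^ a * MeroModForm.e4 ^ (2 - a) := by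
      rw [← pow_add, Nat.add_sub_cancel' ha]
    have h6 : MeroModForm.e6 = MeroModForm.e6 ^ b * MeroModForm.e6 ^ (1 - b) := by
      rw [← pow_add, Nat.add_sub_cancel' hb, pow_one]
    rw [h4, hf_def]
    linear_combination (-1 : ℤ⟦X⟧) * MeroModForm.e4 ^ a * MeroModForm.e4 ^ (2 - a) * h6
  refine ⟨⟨P, MeroModForm.polyP_zero f, fun n hn ↦ ?_, ?_, hcongr⟩, ?_, ?_⟩
  · obtain ⟨n, rfl⟩ := Nat.exists_eq_add_of_lt hn
    rw [zero_add]
    exact MeroModForm.degree_polyP hf1 n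
  · rw [MeroModForm.formF_eq (MeroModForm.map_e4_pow_mul_e6_pow hkab hk'.1 hk'.2)]
    congr 2
    ext n
    rw [Polynomial.aeval_algebraMap_apply, Polynomial.aeval_X_left_apply]
  · intro p hp c
    refine ⟨fun n ↦ Polynomial.aeval c (P n), fun n _ ↦ ?_, fun n l hn _ ↦ ?_⟩
    · rw [MeroModForm.coeffF_eq (MeroModForm.map_e4_pow_mul_e6_pow hkab hk'.1 hk'.2)]
      exact (Polynomial.aeval_algebraMap_apply (PadicAlgCl p) c (P n)).symm
    · simpa using map_dvd (Polynomial.aeval (R := ℤ) c)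
        (MeroModForm.C_dvd_sub_pow hp.out (hcongr p hp.out) hn l)
  · intro L _ _ c v p hp hpv hc n hn
    have hf := MeroModForm.map_e4_pow_mul_e6_pow (K := L) hkab hk'.1 hk'.2
    obtain ⟨r, hN⟩ := MeroModForm.exists_absNorm_eq_pow v hp hpv
    set N := Ideal.absNorm v.asIdeal
    have hint (Q : ℤ[X]) := MeroModForm.valuation_aeval_le_one v hc Q
    have hd (m : ℕ) (hm : 0 < m) := MeroModForm.C_dvd_sub_pow hp (hcongr p hp) hm r
    rw [← hN] at hd
    set e := (N - 1) / (p - 1)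
    simp only [MeroModForm.coeffF_eq hf]
    have hmul : v.valuation L (Polynomial.aeval c (P p) ^ e * Polynomial.aeval c (P n)) ≤ 1 := by
      simpa using hint (P p ^ e * P n)
    refine ⟨hint _, ⟨hint _, hmul, ?_⟩, hmul, by simpa using hint (P N * P n), ?_⟩
    · have h1 := MeroModForm.valuation_aeval_sub_lt_one v hpv hc (hd n hn)
      have h2 := MeroModForm.valuation_pow_absNorm_sub_lt_one v (hint (P n))
      have h3 : v.valuation L (Polynomial.aeval c (P p) ^ e *
          (Polynomial.aeval c (P n) ^ N - Polynomial.aeval c (P n))) < 1 := by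
        rw [map_mul, mul_comm]
        exact mul_lt_one_of_lt_of_le h2 (by simpa using hint (P p ^ e))
      rw [map_mul, map_pow, map_pow] at h1
      convert (v.valuation L).map_add_lt h1 h3 using 2
      ring
    · have h1 := MeroModForm.valuation_aeval_sub_lt_one v hpv hc (hd 1 one_pos)
      rw [show P 1 = 1 from MeroModForm.polyP_one hf1, one_pow, mul_one, one_mul, map_pow] at h1
      rw [← sub_mul, map_mul, (v.valuation L).map_sub_swap]
      exact mul_lt_one_of_lt_of_le h1 (hint _)
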